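/- Definitions. Write $[n]=\{1,\dots,n\}$. For $T>0$, the perfect one-cold Poisson channel with duration $T$ takes as input a measurable function $x:[0,T]\to\mathbb{N}=\{1,2,\dots\}$ and outputs independent Poisson counting processes $(Y_i(t))_{t\in[0,T]}$, $i\in\mathbb{N}$, where $Y_i$ has intensity function $t\mapsto 1-\mathbf{1}\{x(t)=i\}$. A coding scheme for $M\ge 1$ messages consists of a channel input $x_k$ for every message $k\in[M]$ and a measurable decoding function from the output to $[M]$; its average error probability is the probability that the decoded message differs from the message, when the message is uniformly distributed on $[M]$. Let $M^*(\infty,0,T,\epsilon)\in\mathbb{N}\cup\{\infty\}$ be the largest $M\in\mathbb{N}$ for which there is a coding scheme for $M$ messages with average error probability at most $\epsilon$ ($\infty$ if there is no largest one), and let $\epsilon^*(\infty,0,T,M)=\inf\{\epsilon\ge 0: M^*(\infty,0,T,\epsilon)\ge M\}$. Statement. (1) For all $T>0$ and $0<\epsilon\le 1/12$, the maximum $M^*(\infty,0,T,\epsilon)$ exists (is finite and attained) and \[ \ln M^*(\infty,0,T,\epsilon)-\max\{T-\ln(1/\epsilon),\,0\}\in[0,2]. \] (2) For every rate $0<R<1$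 we have $\epsilon^*(\infty,0,T,\lceil e^{TR}\rceil)>0$ for all $T>0$, and the error exponent is \[ \liminf_{T\to\infty}\frac1T\ln\frac{1}{\epsilon^*(\infty,0,T,\lceil e^{TR}\rceil)}=1-R. \] -/

import Mathlib

open MeasureTheory ProbabilityTheory Filter Topology
open scoped NNReal ENNReal Nat

namespace OCPC

noncomputable section

/-- The set of bands `[L] = {1, …, L}`; for `L = ⊤` these are all positive integers. -/
abbrev Band (L : ℕ∞) : Type := {i : ℕ // 1 ≤ i ∧ (i : ℕ∞) ≤ L}

/-- The time interval `[0, T]`, with its Borel sets. -/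
abbrev Time (T : ℝ) : Type := Set.Icc (0 : ℝ) T

/-- Lebesgue measure on `[0, T]`. -/
def timeVolume (T : ℝ) : Measure (Time T) := (volume : Measure ℝ).comap Subtype.val

/-- The space of paths `t ↦ Y(t)`, with the σ-algebra generated by the evaluations. -/
abbrev Path (T : ℝ) : Type := Time T → ℕ

/-- The counting path of the points `s 0, …, s (n - 1)` (with multiplicity):
its value at `t` is the number of points in `[0, t]`. -/
def countingPath {T : ℝ} {n : ℕ} (s : Fin n → Time T) : Path T :=
  fun t => (Finset.univ.filter fun j => s j ≤ t).card

lemma measurable_countingPath (T : ℝ) (n : ℕ) :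
    Measurable (countingPath : (Fin n → Time T) → Path T) := by
  refine measurable_pi_lambda _ fun t => ?_
  have h : (fun s : Fin n → Time T => countingPath s t)
      = fun s => ∑ j : Fin n, if s j ≤ t then 1 else 0 := by
    funext s
    exact Finset.card_filter _ _
  rw [h]
  refine Finset.measurable_sum _ fun j _ => ?_
  exact Measurable.ite (measurableSet_le (measurable_pi_apply j) measurable_const)
    measurable_const measurable_const

/-- The law of the Poisson counting process on `[0, T]` with finite intensity measure `ν`:
the number `n` of points is Poisson with mean `ν([0, T])` and, given `n`, the points are i.i.d.
with law `ν / ν([0, T])`.  The two normalisations cancel, so that the part of the law carried by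
`n` points is `exp (-ν([0, T])) / n!` times the image of the product measure `ν ⊗ ⋯ ⊗ ν`. -/
def poissonProcessLaw {T : ℝ} (ν : Measure (Time T)) : Measure (Path T) :=
  Measure.sum fun n : ℕ =>
    ENNReal.ofReal (Real.exp (-ν.real Set.univ) / (n ! : ℝ)) •
      (Measure.pi fun _ : Fin n => ν).map countingPath

instance isProbabilityMeasure_poissonProcessLaw {T : ℝ} (ν : Measure (Time T))
    [IsFiniteMeasure ν] : IsProbabilityMeasure (poissonProcessLaw ν) := by
  constructor
  have hr : 0 ≤ ν.real Set.univ := measureReal_nonneg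
  have hterm : ∀ n : ℕ, (ENNReal.ofReal (Real.exp (-ν.real Set.univ) / (n ! : ℝ)) •
      (Measure.pi fun _ : Fin n => ν).map (countingPath (T := T))) Set.univ
      = ENNReal.ofReal
        (Real.exp (-ν.real Set.univ) * (ν.real Set.univ) ^ n / (n ! : ℝ)) := by
    intro n
    rw [Measure.smul_apply, Measure.map_apply (measurable_countingPath T n) MeasurableSet.univ,
      Set.preimage_univ, Measure.pi_univ, Finset.prod_const, Finset.card_univ, Fintype.card_fin,
      smul_eq_mul, ← ofReal_measureReal (μ := ν) (s := Set.univ), ← ENNReal.ofReal_pow hr,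
      ← ENNReal.ofReal_mul (by positivity)]
    congr 1
    ring
  have hs : HasSum (fun n : ℕ =>
      Real.exp (-ν.real Set.univ) * (ν.real Set.univ) ^ n / (n ! : ℝ)) 1 :=
    hasSum_one_poissonMeasure ⟨ν.real Set.univ, hr⟩
  rw [poissonProcessLaw, Measure.sum_apply _ MeasurableSet.univ, tsum_congr hterm,
    ← ENNReal.ofReal_tsum_of_nonneg (fun n => by positivity) hs.summable, hs.tsum_eq,
    ENNReal.ofReal_one]

/-- The intensity measure of band `i` under the input `x`: its Lebesgue density at time `t` is
`1 - (1 - α) 1{x(t) = i}`, that is, `α` if `x(t) = i` and `1` otherwise. -/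
def intensity {L : ℕ∞} (α : ℝ≥0) {T : ℝ} (x : Time T → Band L) (i : Band L) :
    Measure (Time T) :=
  (timeVolume T).withDensity fun t => if x t = i then (α : ℝ≥0∞) else 1

instance isFiniteMeasure_intensity {L : ℕ∞} (α : ℝ≥0) {T : ℝ} (x : Time T → Band L)
    (i : Band L) : IsFiniteMeasure (intensity α x i) := by
  refine isFiniteMeasure_withDensity (ne_of_lt ?_)
  have hv : timeVolume T Set.univ < ∞ := by
    rw [timeVolume, (MeasurableEmbedding.subtype_coe measurableSet_Icc).comap_apply,
      Set.image_univ, Subtype.range_coe]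
    exact measure_Icc_lt_top
  calc ∫⁻ t, (if x t = i then (α : ℝ≥0∞) else 1) ∂timeVolume T
      ≤ ∫⁻ _, max (α : ℝ≥0∞) 1 ∂timeVolume T := lintegral_mono fun t => by
        dsimp only
        split_ifs
        · exact le_max_left _ _
        · exact le_max_right _ _
    _ = max (α : ℝ≥0∞) 1 * timeVolume T Set.univ := lintegral_const _
    _ < ∞ := ENNReal.mul_lt_top (max_lt ENNReal.coe_lt_top ENNReal.one_lt_top) hv

/-- The `(L, α)`-one-cold Poisson channel with duration `T`: the law of the output
`(Y_i)_{i ∈ [L]}` given the input `x`.  The `Y_i` are independent Poisson counting processes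
on `[0, T]`, and `Y_i` has intensity function `t ↦ 1 - (1 - α) 1{x(t) = i}`. -/
def channel (L : ℕ∞) (α : ℝ≥0) (T : ℝ) (x : Time T → Band L) : Measure (Band L → Path T) :=
  Measure.infinitePi fun i => poissonProcessLaw (intensity α x i)

/-- A coding scheme with `M` messages: a measurable channel input for every message, and a
measurable decoding function. -/
structure Code (L : ℕ∞) (T : ℝ) (M : ℕ) where
  /-- the channel input of a message -/
  enc : Fin M → Time T → Band L
  measurable_enc : ∀ k, Measurable (enc k)
  /-- the decoded message -/
  dec : (Band L → Path T) → Fin M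
  measurable_dec : Measurable dec

/-- The average error probability for a uniformly distributed message. -/
def Code.avgError {L : ℕ∞} {T : ℝ} {M : ℕ} (c : Code L T M) (α : ℝ≥0) : ℝ :=
  (∑ k : Fin M, (channel L α T (c.enc k)).real {y | c.dec y ≠ k}) / (M : ℝ)

/-- The set of the positive integers `M` for which `M` messages can be sent with average error
probability at most `ε`. -/
def achievable (L : ℕ∞) (α : ℝ≥0) (T ε : ℝ) : Set ℕ :=
  {M | 1 ≤ M ∧ ∃ c : Code L T M, c.avgError α ≤ ε}

/-- `M*(L, α, T, ε)`: the largest achievable number of messages (`⊤` if there is no largest). -/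
def maxMessages (L : ℕ∞) (α : ℝ≥0) (T ε : ℝ) : ℕ∞ :=
  ⨆ M ∈ achievable L α T ε, (M : ℕ∞)

/-- `ε*(L, α, T, M) = inf {ε ≥ 0 : M*(L, α, T, ε) ≥ M}`: the optimal error probability. -/
def optError (L : ℕ∞) (α : ℝ≥0) (T : ℝ) (M : ℕ) : ℝ :=
  sInf {ε : ℝ | 0 ≤ ε ∧ (M : ℕ∞) ≤ maxMessages L α T ε}

end

end OCPC

namespace OCPC

noncomputable section

/-! ### Infinite product measures: boxes and conditioning on a box. -/

section InfiniteProduct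

variable {ι : Type*} {X : ι → Type*} [∀ i, MeasurableSpace (X i)]
  (μ : (i : ι) → Measure (X i)) [∀ i, IsProbabilityMeasure (μ i)]

/-! Put `p = exp (-T)`. Let all bands carry independent Poisson processes of rate 1. Conditioning
this reference law on the event `V k` that no point lies on the graph of `x k` gives the channel law
of `x k` (`channel_eq_map_cond`), and `V k` has probability `p` for every input. With decoding
regions `D k`, the success probabilities therefore sum to `p⁻¹ P(⋃ (V k ∩ D k)) ≤ p⁻¹ P(⋃ V k)`. The
complements of the `V k` are positively associated (`prod_le_refLaw_real_iInter`), so the sum is at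
most `p⁻¹ (1 - (1 - p) ^ M)`.

Constant inputs on distinct bands make the `V k` independent, and choosing the first empty band
attains the bound (`exists_code_avgError_le`). Hence the optimal error is exactly `errorBound p M`.
Both claims follow from elementary estimates: it is about `M p / 2` when `M p` is small, and at
least `1 - 1 / (M p)` always. -/

lemma tendsto_prod_infinitePi [Countable ι] {t : (i : ι) → Set (X i)}
    (ht : ∀ i, MeasurableSet (t i)) :
    Tendsto (fun s : Finset ι => ∏ i ∈ s, μ i (t i)) atTop
      (𝓝 (Measure.infinitePi μ (Set.univ.pi t))) := by
  rw [Measure.infinitePi_pi_univ μ ht]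
  exact (ENNReal.multipliable_of_le_one fun i => prob_le_one).hasProd

/-- Both sides agree on finite-dimensional boxes, which determine a product measure. `hne` is a
separate hypothesis because an infinite product of positive factors may vanish. -/
lemma infinitePi_cond [Countable ι] {A : (i : ι) → Set (X i)} (hA : ∀ i, MeasurableSet (A i))
    (hne : Measure.infinitePi μ (Set.univ.pi A) ≠ 0)
    [∀ i, IsProbabilityMeasure (cond (μ i) (A i))] :
    Measure.infinitePi (fun i => cond (μ i) (A i))
      = cond (Measure.infinitePi μ) (Set.univ.pi A) := by
  classical
  symm
  refine Measure.eq_infinitePi _ fun s t ht => ?_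
  have hAm : MeasurableSet (Set.univ.pi A) := MeasurableSet.pi Set.countable_univ fun i _ => hA i
  -- Padding with the whole space turns both boxes into limits of finite products, which factor over
  -- every finite set containing `s`.
  set t' : (i : ι) → Set (X i) := fun i => if i ∈ s then t i else Set.univ with ht'
  have ht'm : ∀ i, MeasurableSet (t' i) := fun i => by
    simp only [ht']
    split_ifs
    exacts [ht i, MeasurableSet.univ]
  have hset : Set.univ.pi A ∩ Set.pi (s : Set ι) t = Set.univ.pi fun i => A i ∩ t' i := by
    ext y
    simp only [Set.mem_inter_iff, Set.mem_pi, Set.mem_univ, true_imp_iff, ht', forall_and,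
      Finset.mem_coe]
    refine and_congr_right fun _ => forall_congr' fun i => ?_
    by_cases hi : i ∈ s <;> simp [hi]
  have h1 := tendsto_prod_infinitePi μ fun i => (hA i).inter (ht'm i)
  have hfin : (∏ i ∈ s, cond (μ i) (A i) (t i)) ≠ ∞ :=
    ENNReal.prod_ne_top fun i _ => measure_ne_top _ _
  have h2 := ENNReal.Tendsto.mul_const (tendsto_prod_infinitePi μ hA)
    (Or.inr hfin : Measure.infinitePi μ (Set.univ.pi A) ≠ 0 ∨ _)
  have h3 : Measure.infinitePi μ (Set.univ.pi fun i => A i ∩ t' i)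
      = Measure.infinitePi μ (Set.univ.pi A) * ∏ i ∈ s, cond (μ i) (A i) (t i) := by
    refine tendsto_nhds_unique h1 (h2.congr' ?_)
    filter_upwards [eventually_ge_atTop s] with u hu
    have : ∏ i ∈ s, cond (μ i) (A i) (t i) = ∏ i ∈ u, cond (μ i) (A i) (t' i) := by
      refine (Finset.prod_congr rfl fun i hi => by simp [ht', hi]).trans
        (Finset.prod_subset hu fun i _ hi => ?_)
      simp [ht', hi]
    rw [this, ← Finset.prod_mul_distrib]
    refine Finset.prod_congr rfl fun i _ => ?_
    rw [mul_comm, cond_mul_eq_inter (hA i)]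
  rw [cond_apply hAm, hset, h3, ← mul_assoc, ENNReal.inv_mul_cancel hne (measure_ne_top _ _),
    one_mul]

end InfiniteProduct

/-! ### Poisson point configurations and void probabilities. -/

/-- A finite configuration of labelled points of `[0, T]`. -/
abbrev Conf (T : ℝ) : Type := Σ n : ℕ, Fin n → Time T

/-- The configuration of the points `s 0, …, s (n - 1)`. -/
def confMk {T : ℝ} (n : ℕ) (s : Fin n → Time T) : Conf T := ⟨n, s⟩

/-- The law of the points of a Poisson process with intensity measure `ν`. -/
def confLaw {T : ℝ} (ν : Measure (Time T)) : Measure (Conf T) :=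
  Measure.sum fun n : ℕ =>
    ENNReal.ofReal (Real.exp (-ν.real Set.univ) / (n ! : ℝ)) •
      (Measure.pi fun _ : Fin n => ν).map (confMk n)

/-- The counting path of a configuration. -/
def confPath {T : ℝ} (c : Conf T) : Path T := countingPath c.2

/-- The configurations without points in `B`. -/
def voidSet {T : ℝ} (B : Set (Time T)) : Set (Conf T) := {c | ∀ j, c.2 j ∉ B}

variable {T : ℝ}

lemma measurable_confMk (n : ℕ) :
    Measurable (confMk n : (Fin n → Time T) → Conf T) := by
  intro s hs
  exact (MeasurableSpace.measurableSet_iInf.1 hs) n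

lemma measurable_of_sigma {β : Type*} [MeasurableSpace β] {f : Conf T → β}
    (h : ∀ n, Measurable fun s : Fin n → Time T => f ⟨n, s⟩) : Measurable f :=
  fun _ hs => MeasurableSpace.measurableSet_iInf.2 fun n => h n hs

lemma measurable_confPath : Measurable (confPath : Conf T → Path T) :=
  measurable_of_sigma fun n => measurable_countingPath T n

lemma preimage_confMk_voidSet (B : Set (Time T)) (n : ℕ) :
    confMk n ⁻¹' voidSet B = Set.univ.pi fun _ => Bᶜ := by
  ext s
  simp [voidSet, confMk, Set.mem_pi]

lemma measurableSet_voidSet {B : Set (Time T)} (hB : MeasurableSet B) :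
    MeasurableSet (voidSet B) := by
  refine MeasurableSpace.measurableSet_iInf.2 fun n => ?_
  change MeasurableSet (confMk n ⁻¹' voidSet B)
  rw [preimage_confMk_voidSet]
  exact MeasurableSet.univ_pi fun _ => hB.compl

/-- Lets the argument run on configurations, where having no point in `B` is an event for every
measurable `B`; on paths, with the σ-algebra of evaluations, this is not evident. -/
lemma map_confPath_confLaw (ν : Measure (Time T)) :
    (confLaw ν).map confPath = poissonProcessLaw ν := by
  rw [confLaw, poissonProcessLaw, Measure.map_sum measurable_confPath.aemeasurable]
  congr 1
  funext n
  rw [Measure.map_smul, Measure.map_map measurable_confPath (measurable_confMk n)]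
  rfl

instance isProbabilityMeasure_confLaw (ν : Measure (Time T)) [IsFiniteMeasure ν] :
    IsProbabilityMeasure (confLaw ν) := by
  refine ⟨?_⟩
  have h : (confLaw ν).map confPath Set.univ = 1 := by
    rw [map_confPath_confLaw]
    exact measure_univ
  rwa [Measure.map_apply measurable_confPath MeasurableSet.univ, Set.preimage_univ] at h

/-- In the part with `n` points, restriction to the power of `Bᶜ` restricts each factor `ν`; the
weight splits as `exp (-ν B) * exp (-ν Bᶜ)`. -/
lemma confLaw_restrict_voidSet (ν : Measure (Time T)) [IsFiniteMeasure ν] {B : Set (Time T)}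
    (hB : MeasurableSet B) :
    (confLaw ν).restrict (voidSet B)
      = ENNReal.ofReal (Real.exp (-ν.real B)) • confLaw (ν.restrict Bᶜ) := by
  rw [confLaw, confLaw, Measure.restrict_sum _ (measurableSet_voidSet hB)]
  ext s hs
  rw [Measure.smul_apply, Measure.sum_apply _ hs, Measure.sum_apply _ hs, smul_eq_mul,
    ← ENNReal.tsum_mul_left]
  refine tsum_congr fun n => ?_
  rw [← smul_eq_mul, ← Measure.smul_apply]
  congr 1
  rw [Measure.restrict_smul, Measure.restrict_map (measurable_confMk n)
    (measurableSet_voidSet hB), preimage_confMk_voidSet, Measure.restrict_pi_pi, smul_smul,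
    ← ENNReal.ofReal_mul (Real.exp_pos _).le]
  congr 2
  rw [mul_div_assoc', ← Real.exp_add, measureReal_restrict_apply_univ,
    ← measureReal_add_measureReal_compl hB]
  congr 2
  ring

lemma confLaw_voidSet (ν : Measure (Time T)) [IsFiniteMeasure ν] {B : Set (Time T)}
    (hB : MeasurableSet B) :
    confLaw ν (voidSet B) = ENNReal.ofReal (Real.exp (-ν.real B)) := by
  have h := congrArg (fun μ => μ Set.univ) (confLaw_restrict_voidSet ν hB)
  simpa using h

lemma cond_confLaw_voidSet (ν : Measure (Time T)) [IsFiniteMeasure ν] {B : Set (Time T)}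
    (hB : MeasurableSet B) :
    cond (confLaw ν) (voidSet B) = confLaw (ν.restrict Bᶜ) := by
  rw [ProbabilityTheory.cond, confLaw_restrict_voidSet ν hB, confLaw_voidSet ν hB, smul_smul,
    ENNReal.inv_mul_cancel (by simpa using Real.exp_pos _) ENNReal.ofReal_ne_top, one_smul]

lemma timeVolume_univ (hT : 0 ≤ T) : (timeVolume T).real Set.univ = T := by
  rw [Measure.real, timeVolume,
    (MeasurableEmbedding.subtype_coe measurableSet_Icc).comap_apply, Set.image_univ,
    Subtype.range_coe, Real.volume_Icc, sub_zero, ENNReal.toReal_ofReal hT]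

instance isFiniteMeasure_timeVolume : IsFiniteMeasure (timeVolume T) := by
  refine ⟨?_⟩
  rw [timeVolume, (MeasurableEmbedding.subtype_coe measurableSet_Icc).comap_apply,
    Set.image_univ, Subtype.range_coe]
  exact measure_Icc_lt_top

lemma intensity_zero {x : Time T → Band ⊤} (hx : Measurable x) (i : Band ⊤) :
    intensity 0 x i = (timeVolume T).restrict (x ⁻¹' {i})ᶜ := by
  have hm : MeasurableSet (x ⁻¹' {i}) := hx (measurableSet_singleton i)
  rw [intensity, ← withDensity_indicator_one hm.compl]
  congr 1
  funext t
  by_cases h : x t = i <;> simp [h]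

/-! ### The reference law and positive association. -/

/-- The joint law of independent Poisson processes of rate `1` in all bands. -/
def refLaw (T : ℝ) : Measure (Band ⊤ → Conf T) :=
  Measure.infinitePi fun _ => confLaw (timeVolume T)

instance isProbabilityMeasure_refLaw : IsProbabilityMeasure (refLaw T) := by
  unfold refLaw
  infer_instance

/-- The event that there are no points in `G`. -/
def voidEvent (G : Band ⊤ → Set (Time T)) : Set (Band ⊤ → Conf T) :=
  Set.univ.pi fun i => voidSet (G i)

lemma measurableSet_voidEvent {G : Band ⊤ → Set (Time T)} (hG : ∀ i, MeasurableSet (G i)) :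
    MeasurableSet (voidEvent G) :=
  MeasurableSet.pi Set.countable_univ fun i _ => measurableSet_voidSet (hG i)

lemma mem_voidEvent {G : Band ⊤ → Set (Time T)} {ω : Band ⊤ → Conf T} :
    ω ∈ voidEvent G ↔ ∀ i j, (ω i).2 j ∉ G i := by
  simp [voidEvent, voidSet, Set.mem_pi]

lemma voidEvent_inter (G H : Band ⊤ → Set (Time T)) :
    voidEvent G ∩ voidEvent H = voidEvent fun i => G i ∪ H i := by
  ext ω
  simp only [Set.mem_inter_iff, mem_voidEvent, Set.mem_union, not_or, forall_and]

lemma refLaw_voidEvent_inter {G H : Band ⊤ → Set (Time T)} (hG : ∀ i, MeasurableSet (G i))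
    (hH : ∀ i, MeasurableSet (H i)) (hd : ∀ i, Disjoint (G i) (H i)) :
    refLaw T (voidEvent G ∩ voidEvent H)
      = refLaw T (voidEvent G) * refLaw T (voidEvent H) := by
  rw [voidEvent_inter]
  have h := fun {K : Band ⊤ → Set (Time T)} (hK : ∀ i, MeasurableSet (K i)) =>
    tendsto_prod_infinitePi (fun _ : Band ⊤ => confLaw (timeVolume T))
      fun i => measurableSet_voidSet (hK i)
  refine tendsto_nhds_unique (h fun i => (hG i).union (hH i))
    ((ENNReal.Tendsto.mul (h hG) (Or.inr (measure_ne_top (refLaw T) _)) (h hH)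
      (Or.inr (measure_ne_top (refLaw T) _))).congr fun s => ?_)
  rw [← Finset.prod_mul_distrib]
  refine Finset.prod_congr rfl fun i _ => ?_
  rw [confLaw_voidSet _ (hG i), confLaw_voidSet _ (hH i),
    confLaw_voidSet _ ((hG i).union (hH i)), ← ENNReal.ofReal_mul (Real.exp_pos _).le,
    ← Real.exp_add, measureReal_union (hd i) (hH i)]
  congr 2
  ring

/-- The void event of `G` is independent of what happens outside of `G`. -/
lemma refLaw_real_inter_void_compl {κ : Type*} (s : Finset κ) {G : Band ⊤ → Set (Time T)}
    {H : κ → Band ⊤ → Set (Time T)} (hG : ∀ i, MeasurableSet (G i))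
    (hH : ∀ k i, MeasurableSet (H k i)) (hd : ∀ k i, Disjoint (G i) (H k i)) :
    (refLaw T).real (voidEvent G ∩ ⋂ k ∈ s, (voidEvent (H k))ᶜ)
      = (refLaw T).real (voidEvent G) * (refLaw T).real (⋂ k ∈ s, (voidEvent (H k))ᶜ) := by
  -- Void events of sets disjoint from `G` form a π-system, since intersecting them unites the sets.
  -- Independence then extends to the generated σ-algebra, which contains the complements.
  set p2 : Set (Set (Band ⊤ → Conf T)) :=
    {A | ∃ K : Band ⊤ → Set (Time T), (∀ i, MeasurableSet (K i)) ∧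
      (∀ i, Disjoint (G i) (K i)) ∧ A = voidEvent K} with hp2
  have hpi : IsPiSystem p2 := by
    rintro _ ⟨K, hK, hKd, rfl⟩ _ ⟨L, hL, hLd, rfl⟩ -
    exact ⟨fun i => K i ∪ L i, fun i => (hK i).union (hL i),
      fun i => Set.disjoint_union_right.2 ⟨hKd i, hLd i⟩, voidEvent_inter K L⟩
  have hindep : Indep (MeasurableSpace.generateFrom {voidEvent G})
      (MeasurableSpace.generateFrom p2) (refLaw T) := by
    refine IndepSets.indep' ?_ ?_ (IsPiSystem.singleton _) hpi ?_
    · rintro _ rfl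
      exact measurableSet_voidEvent hG
    · rintro _ ⟨K, hK, -, rfl⟩
      exact measurableSet_voidEvent hK
    · rw [IndepSets_iff]
      rintro _ _ rfl ⟨K, hK, hKd, rfl⟩
      exact refLaw_voidEvent_inter hG hK hKd
  have h := (Indep_iff _ _ _).1 hindep (voidEvent G) (⋂ k ∈ s, (voidEvent (H k))ᶜ)
    (MeasurableSpace.measurableSet_generateFrom rfl)
    (Finset.measurableSet_biInter s fun k _ => MeasurableSet.compl
      (MeasurableSpace.measurableSet_generateFrom ⟨H k, hH k, hd k, rfl⟩))
  simp only [Measure.real, h, ENNReal.toReal_mul]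

/-- Events that there is a point in a given set are positively associated. -/
lemma prod_le_refLaw_real_iInter {κ : Type*} (s : Finset κ) {G : κ → Band ⊤ → Set (Time T)}
    (hG : ∀ k i, MeasurableSet (G k i)) :
    ∏ k ∈ s, (1 - (refLaw T).real (voidEvent (G k)))
      ≤ (refLaw T).real (⋂ k ∈ s, (voidEvent (G k))ᶜ) := by
  classical
  induction s using Finset.induction_on with
  | empty => simp
  | insert a s ha ih =>
    rw [Finset.prod_insert ha]
    set W := ⋂ k ∈ s, (voidEvent (G k))ᶜ with hW
    -- Given no point in `G a`, the set `G k` is hit exactly when `G k \ G a` is. So `W` and `W'`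
    -- agree on `voidEvent (G a)`, and `W'` is independent of that event.
    set W' := ⋂ k ∈ s, (voidEvent fun i => G k i \ G a i)ᶜ with hW'
    have hWm : MeasurableSet W :=
      Finset.measurableSet_biInter s fun k _ => (measurableSet_voidEvent (hG k)).compl
    have h1 : (⋂ k ∈ insert a s, (voidEvent (G k))ᶜ) = W \ voidEvent (G a) := by
      rw [Finset.set_biInter_insert, Set.inter_comm, Set.sdiff_eq]
    have hsub : W' ⊆ W := by
      refine Set.iInter₂_mono fun k _ => Set.compl_subset_compl.2 fun ω hω => ?_
      rw [mem_voidEvent] at hω ⊢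
      exact fun i j hj => hω i j hj.1
    have h2 : W ∩ voidEvent (G a) = voidEvent (G a) ∩ W' := by
      rw [Set.inter_comm]
      ext ω
      refine and_congr_right fun hω => ?_
      simp only [hW, hW', Set.mem_iInter, Set.mem_compl_iff, mem_voidEvent, Set.mem_sdiff] at hω ⊢
      refine forall₂_congr fun k _ => not_congr (forall₂_congr fun i j => ?_)
      simp [hω i j]
    have h3 := refLaw_real_inter_void_compl s (hG a)
      (H := fun k i => G k i \ G a i) (fun k i => (hG k i).diff (hG a i))
      fun k i => Set.disjoint_sdiff_right
    have h4 : (refLaw T).real W' ≤ (refLaw T).real W := measureReal_mono hsub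
    have h5 := measureReal_inter_add_sdiff (μ := refLaw T) (s := W) (measurableSet_voidEvent (hG a))
    rw [h1]
    rw [h2, h3] at h5
    have h6 : 0 ≤ (refLaw T).real (voidEvent (G a)) := measureReal_nonneg
    have h7 : (refLaw T).real (voidEvent (G a)) ≤ 1 := measureReal_le_one
    -- With `v` the probability of `voidEvent (G a)`: `P(W) - v P(W') ≥ (1 - v) P(W)`, then the
    -- induction hypothesis.
    nlinarith [mul_le_mul_of_nonneg_left h4 h6,
      mul_le_mul_of_nonneg_left ih (sub_nonneg.2 h7)]

/-! ### The channel as a conditioned reference law, and the converse bound. -/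

/-- The set of the pairs `(x t, t)`. -/
def inputGraph (x : Time T → Band ⊤) (i : Band ⊤) : Set (Time T) := x ⁻¹' {i}

lemma measurableSet_inputGraph {x : Time T → Band ⊤} (hx : Measurable x) (i : Band ⊤) :
    MeasurableSet (inputGraph x i) := hx (measurableSet_singleton i)

/-- The fibres of `x` partition `[0, T]`, so their lengths sum to `T` whatever the input is. -/
lemma refLaw_voidEvent_inputGraph (hT : 0 ≤ T) {x : Time T → Band ⊤} (hx : Measurable x) :
    refLaw T (voidEvent (inputGraph x)) = ENNReal.ofReal (Real.exp (-T)) := by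
  have hm := measurableSet_inputGraph hx
  have h := tendsto_prod_infinitePi (fun _ : Band ⊤ => confLaw (timeVolume T))
    fun i => measurableSet_voidSet (hm i)
  refine tendsto_nhds_unique h ?_
  have hsum : HasSum (fun i => (timeVolume T).real (inputGraph x i)) T := by
    have hU : (⋃ i, inputGraph x i) = Set.univ := by
      ext t
      simp [inputGraph]
    have hd : Pairwise (Function.onFun Disjoint (inputGraph x)) :=
      fun i j hij => Disjoint.preimage _ (Set.disjoint_singleton.2 hij)
    have htsum : ∑' i, timeVolume T (inputGraph x i) = timeVolume T Set.univ := by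
      rw [← hU, measure_iUnion hd hm]
    have hs := ENNReal.hasSum_toReal (htsum ▸ measure_ne_top (timeVolume T) Set.univ)
    rw [← ENNReal.tsum_toReal_eq fun i => measure_ne_top _ _, htsum] at hs
    rwa [← Measure.real, timeVolume_univ hT] at hs
  have h2 := (ENNReal.continuous_ofReal.comp (Real.continuous_exp.comp continuous_neg)).tendsto T
    |>.comp hsum
  refine h2.congr fun s => ?_
  simp only [Function.comp_apply, confLaw_voidSet _ (hm _)]
  rw [← ENNReal.ofReal_prod_of_nonneg fun i _ => (Real.exp_pos _).le, ← Real.exp_sum,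
    Finset.sum_neg_distrib]

lemma channel_eq_map_cond (hT : 0 ≤ T) {x : Time T → Band ⊤} (hx : Measurable x) :
    channel ⊤ 0 T x
      = (cond (refLaw T) (voidEvent (inputGraph x))).map fun ω i => confPath (ω i) := by
  have hm := measurableSet_inputGraph hx
  have hc : ∀ i, cond (confLaw (timeVolume T)) (voidSet (inputGraph x i))
      = confLaw (intensity 0 x i) := fun i => by
    rw [intensity_zero hx, cond_confLaw_voidSet _ (hm i)]
    rfl
  have : ∀ i, IsProbabilityMeasure
      (cond (confLaw (timeVolume T)) (voidSet (inputGraph x i))) := fun i => by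
    rw [hc]
    infer_instance
  have hne : refLaw T (voidEvent (inputGraph x)) ≠ 0 := by
    rw [refLaw_voidEvent_inputGraph hT hx]
    simpa using Real.exp_pos _
  have h := infinitePi_cond (fun _ : Band ⊤ => confLaw (timeVolume T))
    (fun i => measurableSet_voidSet (hm i)) hne
  rw [refLaw, voidEvent, ← h, Measure.infinitePi_map_pi _ fun _ => measurable_confPath]
  simp only [hc, map_confPath_confLaw]
  rfl

lemma measurable_confPaths :
    Measurable fun (ω : Band ⊤ → Conf T) (i : Band ⊤) => confPath (ω i) :=
  measurable_pi_lambda _ fun i => measurable_confPath.comp (measurable_pi_apply i)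

instance isProbabilityMeasure_channel (L : ℕ∞) (α : ℝ≥0) (x : Time T → Band L) :
    IsProbabilityMeasure (channel L α T x) := by
  unfold channel
  infer_instance

/-- The common normalisation `exp (-T)` allows the success probabilities to be added as
probabilities of disjoint subsets of `⋃ k, V k`. -/
lemma sum_success_le (hT : 0 ≤ T) {M : ℕ} (c : Code ⊤ T M) :
    ∑ k, (channel ⊤ 0 T (c.enc k)).real {y | c.dec y = k}
      ≤ ∑ j ∈ Finset.range M, (1 - Real.exp (-T)) ^ j := by
  set V : Fin M → Set (Band ⊤ → Conf T) := fun k => voidEvent (inputGraph (c.enc k)) with hV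
  set D : Fin M → Set (Band ⊤ → Conf T) := fun k => {ω | c.dec (fun i => confPath (ω i)) = k}
    with hD
  have hG := fun k => measurableSet_inputGraph (c.measurable_enc k)
  have hVm : ∀ k, MeasurableSet (V k) := fun k => measurableSet_voidEvent (hG k)
  have hDm : ∀ k, MeasurableSet (D k) := fun k =>
    (c.measurable_dec.comp measurable_confPaths) (measurableSet_singleton k)
  have hp := Real.exp_pos (-T)
  have hVp : ∀ k, (refLaw T).real (V k) = Real.exp (-T) := fun k => by
    rw [Measure.real, refLaw_voidEvent_inputGraph hT (c.measurable_enc k),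
      ENNReal.toReal_ofReal hp.le]
  have hk : ∀ k, (channel ⊤ 0 T (c.enc k)).real {y | c.dec y = k}
      = (Real.exp (-T))⁻¹ * (refLaw T).real (V k ∩ D k) := fun k => by
    have hDk : MeasurableSet {y | c.dec y = k} := c.measurable_dec (measurableSet_singleton k)
    rw [channel_eq_map_cond hT (c.measurable_enc k),
      map_measureReal_apply measurable_confPaths hDk, Measure.real, cond_apply (hVm k),
      ENNReal.toReal_mul, ENNReal.toReal_inv]
    exact congrArg (fun a => a⁻¹ * (refLaw T).real (V k ∩ D k)) (hVp k)
  have hdisj : Pairwise (Function.onFun Disjoint fun k => V k ∩ D k) := fun k l hkl =>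
    Set.disjoint_left.2 fun ω h1 h2 => hkl (h1.2.symm.trans h2.2)
  have hU : (⋃ k, V k) = (⋂ k ∈ Finset.univ, (V k)ᶜ)ᶜ := by
    simp [Set.compl_iInter]
  have hlow := prod_le_refLaw_real_iInter Finset.univ hG
  rw [Finset.prod_congr rfl fun k _ => by rw [show (refLaw T).real
    (voidEvent (inputGraph (c.enc k))) = _ from hVp k], Finset.prod_const, Finset.card_univ,
    Fintype.card_fin] at hlow
  have hgeom := mul_neg_geom_sum (1 - Real.exp (-T)) M
  rw [sub_sub_cancel] at hgeom
  simp only [hk]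
  rw [← Finset.mul_sum, inv_mul_le_iff₀ hp, hgeom,
    ← measureReal_iUnion_fintype hdisj fun k => (hVm k).inter (hDm k)]
  calc (refLaw T).real (⋃ k, V k ∩ D k) ≤ (refLaw T).real (⋃ k, V k) :=
        measureReal_mono (Set.iUnion_mono fun k => Set.inter_subset_left)
    _ = 1 - (refLaw T).real (⋂ k ∈ Finset.univ, (V k)ᶜ) := by
        rw [hU, probReal_compl_eq_one_sub
          (Finset.measurableSet_biInter _ fun k _ => (hVm k).compl)]
    _ ≤ 1 - (1 - Real.exp (-T)) ^ M := sub_le_sub_left hlow 1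

/-- The optimal average error probability for `M` messages, where `p` is the probability that a
process of rate `1` has no points. -/
def errorBound (p : ℝ) (M : ℕ) : ℝ := (∑ j ∈ Finset.range M, (1 - (1 - p) ^ j)) / M

lemma avgError_eq {M : ℕ} (c : Code ⊤ T M) :
    c.avgError 0
      = (M - ∑ k, (channel ⊤ 0 T (c.enc k)).real {y | c.dec y = k}) / M := by
  rw [Code.avgError]
  congr 1
  have h : ∀ k, (channel ⊤ 0 T (c.enc k)).real {y | c.dec y ≠ k}
      = 1 - (channel ⊤ 0 T (c.enc k)).real {y | c.dec y = k} := fun k =>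
    probReal_compl_eq_one_sub (c.measurable_dec (measurableSet_singleton k))
  simp [h, Finset.sum_sub_distrib]

lemma errorBound_le_avgError (hT : 0 ≤ T) {M : ℕ} (c : Code ⊤ T M) :
    errorBound (Real.exp (-T)) M ≤ c.avgError 0 := by
  rw [avgError_eq, errorBound]
  have h := sum_success_le hT c
  gcongr
  simp only [Finset.sum_sub_distrib, Finset.sum_const, Finset.card_range, nsmul_eq_mul, mul_one]
  linarith

/-! ### Achievability with constant inputs. -/

lemma poissonProcessLaw_real_eq_zero (hT : 0 ≤ T) (ν : Measure (Time T)) [IsFiniteMeasure ν] :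
    (poissonProcessLaw ν).real {y | y ⟨T, hT, le_rfl⟩ = 0} = Real.exp (-ν.real Set.univ) := by
  have hm : MeasurableSet {y : Path T | y ⟨T, hT, le_rfl⟩ = 0} :=
    measurable_pi_apply _ (measurableSet_singleton 0)
  have hpre : confPath ⁻¹' {y : Path T | y ⟨T, hT, le_rfl⟩ = 0} = voidSet Set.univ := by
    ext c
    have hle : ∀ j, c.2 j ≤ (⟨T, hT, le_rfl⟩ : Time T) := fun j => (c.2 j).2.2
    simp only [Set.mem_preimage, Set.mem_ofPred_eq, confPath, countingPath, voidSet,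
      Finset.card_eq_zero, Finset.filter_eq_empty_iff, Finset.mem_univ, true_imp_iff,
      Set.mem_univ, hle]
  rw [← map_confPath_confLaw, map_measureReal_apply measurable_confPath hm, hpre, Measure.real,
    confLaw_voidSet ν MeasurableSet.univ, ENNReal.toReal_ofReal (Real.exp_pos _).le]

/-- The band of the `k`-th message in the constant-input code. -/
def messageBand (k : ℕ) : Band ⊤ := ⟨k + 1, k.succ_pos, le_top⟩

lemma messageBand_injective : Function.Injective messageBand := fun _ _ h =>
  Nat.succ_injective (Subtype.ext_iff.1 h)

lemma intensity_const_self (b : Band ⊤) : intensity 0 (fun _ : Time T => b) b = 0 := by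
  rw [intensity_zero measurable_const]
  simp

lemma intensity_const_of_ne {b i : Band ⊤} (h : b ≠ i) :
    intensity 0 (fun _ : Time T => b) i = timeVolume T := by
  rw [intensity_zero measurable_const, Set.preimage_const_of_notMem (by simpa using h)]
  simp

lemma exists_first_zero_decoder {M : ℕ} (hM : 1 ≤ M) :
    ∃ g : (Fin M → ℕ) → Fin M, ∀ v k, v k = 0 → (∀ j < k, v j ≠ 0) → g v = k := by
  have h : ∀ v : Fin M → ℕ, ∃ l : Fin M, ∀ k, v k = 0 → (∀ j < k, v j ≠ 0) → l = k := by
    intro v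
    by_cases hv : ∃ l, v l = 0 ∧ ∀ j < l, v j ≠ 0
    · obtain ⟨l, h0, hl⟩ := hv
      refine ⟨l, fun k hk hk' => le_antisymm (not_lt.1 fun h => hl k h hk)
        (not_lt.1 fun h => hk' l h h0)⟩
    -- No count is zero: any message will do, and `1 ≤ M` supplies one.
    · exact ⟨⟨0, hM⟩, fun k hk hk' => (hv ⟨k, hk, hk'⟩).elim⟩
  choose g hg using h
  exact ⟨g, hg⟩

/-- Band `k` is almost surely empty, and each of the `k` earlier bands independently has a point
with probability `1 - exp (-T)`. -/
lemma channel_const_real_first_zero (hT : 0 ≤ T) (k : ℕ) :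
    (1 - Real.exp (-T)) ^ k ≤
      (channel ⊤ 0 T fun _ => messageBand k).real
        {y | y (messageBand k) ⟨T, hT, le_rfl⟩ = 0 ∧
          ∀ j < k, y (messageBand j) ⟨T, hT, le_rfl⟩ ≠ 0} := by
  set τ : Time T := ⟨T, hT, le_rfl⟩ with hτ
  set Z : Set (Path T) := {y | y τ = 0} with hZ
  have hZm : MeasurableSet Z := measurable_pi_apply _ (measurableSet_singleton 0)
  set t : Band ⊤ → Set (Path T) := fun i => if i = messageBand k then Z else Zᶜ with ht
  have htm : ∀ i, MeasurableSet (t i) := fun i => by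
    simp only [ht]
    split_ifs
    exacts [hZm, hZm.compl]
  set s : Finset (Band ⊤) := (Finset.range (k + 1)).image messageBand with hs
  have hsub : Set.pi (s : Set (Band ⊤)) t ⊆ {y | y (messageBand k) τ = 0 ∧
      ∀ j < k, y (messageBand j) τ ≠ 0} := by
    intro y hy
    have hy' : ∀ j < k + 1, y (messageBand j) ∈ t (messageBand j) := fun j hj =>
      hy _ (Finset.mem_coe.2 (Finset.mem_image_of_mem _ (Finset.mem_range.2 hj)))
    refine ⟨by simpa [ht, hZ] using hy' k k.lt_succ_self, fun j hj => ?_⟩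
    have := hy' j (hj.trans k.lt_succ_self)
    simpa [ht, hZ, messageBand_injective.ne hj.ne] using this
  refine le_trans (le_of_eq ?_) (measureReal_mono hsub)
  rw [Measure.real, channel, Measure.infinitePi_pi _ fun i _ => htm i, ENNReal.toReal_prod, hs,
    Finset.prod_image messageBand_injective.injOn, Finset.prod_range_succ]
  have hk : (poissonProcessLaw (intensity 0 (fun _ : Time T => messageBand k)
      (messageBand k)) (t (messageBand k))).toReal = 1 := by
    have := poissonProcessLaw_real_eq_zero hT
      (intensity 0 (fun _ : Time T => messageBand k) (messageBand k))
    rw [intensity_const_self] at this ⊢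
    simpa [ht, Measure.real] using this
  rw [hk, mul_one, ← Finset.card_range k, ← Finset.prod_const, Finset.card_range]
  refine Finset.prod_congr rfl fun j hj => ?_
  have hne : messageBand k ≠ messageBand j := messageBand_injective.ne (Finset.mem_range.1 hj).ne'
  rw [intensity_const_of_ne hne, ← Measure.real,
    show t (messageBand j) = Zᶜ from if_neg hne.symm, probReal_compl_eq_one_sub hZm,
    poissonProcessLaw_real_eq_zero hT, timeVolume_univ hT]

lemma exists_code_avgError_le (hT : 0 ≤ T) {M : ℕ} (hM : 1 ≤ M) :
    ∃ c : Code ⊤ T M, c.avgError 0 ≤ errorBound (Real.exp (-T)) M := by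
  obtain ⟨g, hg⟩ := exists_first_zero_decoder hM
  set τ : Time T := ⟨T, hT, le_rfl⟩ with hτ
  let c : Code ⊤ T M :=
    { enc := fun k _ => messageBand k
      measurable_enc := fun k => measurable_const
      dec := fun y => g fun k => y (messageBand k) τ
      measurable_dec := (measurable_of_countable g).comp <| measurable_pi_lambda _ fun k =>
        (measurable_pi_apply τ).comp (measurable_pi_apply (messageBand k)) }
  refine ⟨c, ?_⟩
  have h : ∀ k : Fin M, (1 - Real.exp (-T)) ^ (k : ℕ)
      ≤ (channel ⊤ 0 T (c.enc k)).real {y | c.dec y = k} := fun k =>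
    (channel_const_real_first_zero hT k).trans <| measureReal_mono fun y hy =>
      hg _ k hy.1 fun j hj => hy.2 j hj
  have hsum := Finset.sum_le_sum fun k (_ : k ∈ Finset.univ) => h k
  rw [Fin.sum_univ_eq_sum_range (fun j => (1 - Real.exp (-T)) ^ j) M] at hsum
  rw [avgError_eq, errorBound]
  gcongr
  simp only [Finset.sum_sub_distrib, Finset.sum_const, Finset.card_range, nsmul_eq_mul, mul_one]
  linarith

lemma mem_achievable_iff (hT : 0 ≤ T) {ε : ℝ} {M : ℕ} :
    M ∈ achievable ⊤ 0 T ε ↔ 1 ≤ M ∧ errorBound (Real.exp (-T)) M ≤ ε := by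
  refine and_congr_right fun hM => ⟨fun ⟨c, hc⟩ => (errorBound_le_avgError hT c).trans hc,
    fun h => ?_⟩
  obtain ⟨c, hc⟩ := exists_code_avgError_le hT hM
  exact ⟨c, hc.trans h⟩

/-! ### Estimates of the optimal error. -/

lemma errorBound_nonneg {p : ℝ} (hp0 : 0 ≤ p) (hp1 : p ≤ 1) (M : ℕ) : 0 ≤ errorBound p M :=
  div_nonneg (Finset.sum_nonneg fun _ _ =>
    sub_nonneg.2 (pow_le_one₀ (by linarith) (by linarith))) M.cast_nonneg

/-- `errorBound` averages a nondecreasing sequence, so the next term is at least the current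
average. -/
lemma errorBound_le_succ {p : ℝ} (hp0 : 0 ≤ p) (hp1 : p ≤ 1) {M : ℕ} (hM : 1 ≤ M) :
    errorBound p M ≤ errorBound p (M + 1) := by
  have hM' : (0 : ℝ) < M := by exact_mod_cast hM
  rw [errorBound, errorBound, div_le_div_iff₀ hM' (by positivity), Finset.sum_range_succ]
  have h : ∑ j ∈ Finset.range M, (1 - (1 - p) ^ j) ≤ M * (1 - (1 - p) ^ M) := by
    refine (Finset.sum_le_sum fun j hj => sub_le_sub_left
      (pow_le_pow_of_le_one (by linarith) (by linarith) (Finset.mem_range.1 hj).le) 1).trans ?_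
    simp [mul_sub]
  push_cast
  linarith

lemma errorBound_mono {p : ℝ} (hp0 : 0 ≤ p) (hp1 : p ≤ 1) {M N : ℕ} (hM : 1 ≤ M)
    (hMN : M ≤ N) :
    errorBound p M ≤ errorBound p N := by
  induction N, hMN using Nat.le_induction with
  | base => rfl
  | succ N hN ih => exact ih.trans (errorBound_le_succ hp0 hp1 (hM.trans hN))

lemma errorBound_le {p : ℝ} (hp1 : p ≤ 1) {M : ℕ} (hM : 1 ≤ M) :
    errorBound p M ≤ (M - 1) * p / 2 := by
  have hM' : (0 : ℝ) < M := by exact_mod_cast hM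
  have h : ∀ N : ℕ, ∑ j ∈ Finset.range N, (1 - (1 - p) ^ j) ≤ N * (N - 1) * p / 2 := by
    intro N
    induction N with
    | zero => simp
    | succ N ih =>
      have hb := one_add_mul_le_pow (a := -p) (by linarith) N
      rw [Finset.sum_range_succ]
      push_cast
      rw [← sub_eq_add_neg] at hb
      linarith
  rw [errorBound, div_le_iff₀ hM']
  linarith [h M]

lemma one_sub_pow_le {p : ℝ} (hp0 : 0 ≤ p) (hp1 : p ≤ 1) (j : ℕ) :
    (1 - p) ^ j ≤ 1 - j * p + j * (j - 1) / 2 * p ^ 2 := by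
  induction j with
  | zero => simp
  | succ j ih =>
    have hj : (0 : ℝ) ≤ j * (j - 1) := by
      rcases j with _ | j
      · simp
      · push_cast
        rw [add_sub_cancel_right]
        positivity
    rw [pow_succ]
    push_cast
    nlinarith [mul_le_mul_of_nonneg_right ih (sub_nonneg.2 hp1), mul_nonneg hj (pow_nonneg hp0 3)]

/-- Sums the second-order Bonferroni bound `one_sub_pow_le`; useful while `M * p` is bounded. -/
lemma le_errorBound {p : ℝ} (hp0 : 0 ≤ p) (hp1 : p ≤ 1) {M : ℕ} (hM : 1 ≤ M) :
   
    (M - 1) * p / 2 * (1 - (M - 2) * p / 3) ≤ errorBound p M := by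
  have hM' : (0 : ℝ) < M := by exact_mod_cast hM
  have h : ∀ N : ℕ, N * (N - 1) * p / 2 * (1 - (N - 2) * p / 3)
      ≤ ∑ j ∈ Finset.range N, (1 - (1 - p) ^ j) := by
    intro N
    induction N with
    | zero => simp
    | succ N ih =>
      have hb := one_sub_pow_le hp0 hp1 N
      rw [Finset.sum_range_succ]
      push_cast
      linarith
  rw [errorBound, le_div_iff₀ hM']
  linarith [h M]

/-- The geometric sum is at most `1 / p`; useful when `M * p` is large. -/
lemma one_sub_inv_le_errorBound {p : ℝ} (hp : 0 < p) (hp1 : p ≤ 1) {M : ℕ} (hM : 1 ≤ M) :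
    1 - (M * p)⁻¹ ≤ errorBound p M := by
  have hM' : (0 : ℝ) < M := by exact_mod_cast hM
  have hgeom := mul_neg_geom_sum (1 - p) M
  rw [sub_sub_cancel] at hgeom
  have h1 : ∑ j ∈ Finset.range M, (1 - p) ^ j ≤ p⁻¹ := by
    rw [← mul_le_mul_iff_right₀ hp, hgeom, mul_inv_cancel₀ hp.ne']
    linarith [pow_nonneg (sub_nonneg.2 hp1) M]
  rw [errorBound, le_div_iff₀ hM', mul_inv, sub_mul, mul_right_comm, inv_mul_cancel₀ hM'.ne']
  simp only [Finset.sum_sub_distrib, Finset.sum_const, Finset.card_range, nsmul_eq_mul, mul_one]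
  linarith

lemma cast_le_of_errorBound_le {p ε : ℝ} (hp : 0 < p) (hp1 : p ≤ 1) (hε : ε ≤ 1 / 12) {M : ℕ}
    (hM : 1 ≤ M) (h : errorBound p M ≤ ε) : (M : ℝ) ≤ Real.exp 2 * max (ε / p) 1 := by
  by_contra! hlt
  have he : (7.3 : ℝ) < Real.exp 2 := by
    have h1 := Real.exp_one_gt_d9
    have h2 : Real.exp 2 = Real.exp 1 * Real.exp 1 := by
      rw [← Real.exp_add]
      norm_num
    nlinarith
  have h1 : Real.exp 2 * 1 < M :=
    (mul_le_mul_of_nonneg_left (le_max_right _ _) (by linarith)).trans_lt hlt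
  have h2 : Real.exp 2 * (ε / p) < M :=
    (mul_le_mul_of_nonneg_left (le_max_left _ _) (by linarith)).trans_lt hlt
  have h8 : (8 : ℝ) ≤ M := by
    have : 7 < M := by
      have : (7 : ℝ) < M := by linarith
      exact_mod_cast this
    exact_mod_cast this
  have hε0 : 0 ≤ ε := (errorBound_nonneg hp.le hp1 M).trans h
  have h3 : 7.3 * ε < M * p := by
    rw [mul_div_assoc', div_lt_iff₀ hp] at h2
    nlinarith
  -- If `M p ≤ 2`, then `M ≥ 8` gives error at least `(7/8)(1/2)(1/3) M p = (7/48) M p`, above `ε`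
  -- since `7.3 * 7 > 48`. Otherwise the error is at least `1/2 > 1/12`.
  rcases le_total (M * p) 2 with hle | hge
  · have h4 := le_errorBound hp.le hp1 hM
    have h5 : 1 / 3 ≤ 1 - ((M : ℝ) - 2) * p / 3 := by nlinarith
    have h6 : 7 / 8 * (M * p) ≤ (M - 1) * p := by nlinarith
    have h7 : ((M : ℝ) - 1) * p / 2 * (1 / 3) ≤ (M - 1) * p / 2 * (1 - (M - 2) * p / 3) :=
      mul_le_mul_of_nonneg_left h5 (by nlinarith)
    linarith
  · have h4 := one_sub_inv_le_errorBound hp hp1 hM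
    have h5 : (M * p)⁻¹ ≤ (2 : ℝ)⁻¹ := inv_anti₀ two_pos hge
    linarith

/-! ### The largest code size and the error exponent. -/

lemma maxMessages_eq_of_isGreatest {L : ℕ∞} {α : ℝ≥0} {T ε : ℝ} {m : ℕ}
    (h : IsGreatest (achievable L α T ε) m) : maxMessages L α T ε = m :=
  le_antisymm (iSup₂_le fun _ hM => Nat.cast_le.2 (h.2 hM)) (le_iSup₂_of_le m h.1 le_rfl)

lemma exists_isGreatest_achievable {T ε : ℝ} (hT : 0 ≤ T) (hε : 0 < ε) (hε' : ε ≤ 1 / 12) :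
    ∃ m, IsGreatest (achievable ⊤ 0 T ε) m ∧
      max (ε * Real.exp T) 1 ≤ m ∧ (m : ℝ) ≤ Real.exp 2 * max (ε * Real.exp T) 1 := by
  have hp := Real.exp_pos (-T)
  have hp1 : Real.exp (-T) ≤ 1 := Real.exp_le_one_iff.2 (by linarith)
  have hup : ∀ M ∈ achievable ⊤ 0 T ε, (M : ℝ) ≤ Real.exp 2 * max (ε * Real.exp T) 1 := by
    intro M hM
    rw [mem_achievable_iff hT] at hM
    have := cast_le_of_errorBound_le hp hp1 hε' hM.1 hM.2
    rwa [Real.exp_neg, div_inv_eq_mul] at this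
  have hpos : 0 < ε * Real.exp T := mul_pos hε (Real.exp_pos T)
  -- Chosen so that the upper bound `(N - 1) * p / 2` is at most `ε`.
  set N := ⌊1 + 2 * (ε * Real.exp T)⌋₊ with hN
  have hN1 : 1 ≤ N := Nat.le_floor (by push_cast; linarith)
  have hNle : (N : ℝ) ≤ 1 + 2 * (ε * Real.exp T) := Nat.floor_le (by linarith)
  have hNmem : N ∈ achievable ⊤ 0 T ε := by
    refine (mem_achievable_iff hT).2 ⟨hN1, (errorBound_le hp1 hN1).trans ?_⟩
    have h1 : ((N : ℝ) - 1) * Real.exp (-T) ≤ 2 * (ε * Real.exp T) * Real.exp (-T) :=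
      mul_le_mul_of_nonneg_right (by linarith) hp.le
    have h2 : Real.exp T * Real.exp (-T) = 1 := by
      rw [← Real.exp_add, add_neg_cancel, Real.exp_zero]
    rw [mul_assoc, mul_assoc, h2] at h1
    linarith
  have hbdd : BddAbove (achievable ⊤ 0 T ε) :=
    ⟨⌊Real.exp 2 * max (ε * Real.exp T) 1⌋₊, fun M hM => Nat.le_floor (hup M hM)⟩
  have hgr : IsGreatest (achievable ⊤ 0 T ε) (sSup (achievable ⊤ 0 T ε)) :=
    ⟨Nat.sSup_mem ⟨N, hNmem⟩ hbdd, fun M hM => le_csSup hbdd hM⟩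
  refine ⟨_, hgr, ?_, hup _ hgr.1⟩
  have hNs : (N : ℝ) ≤ (sSup (achievable ⊤ 0 T ε) : ℕ) := by exact_mod_cast hgr.2 hNmem
  have hlt : 1 + 2 * (ε * Real.exp T) < N + 1 := Nat.lt_floor_add_one _
  have hN1' : (1 : ℝ) ≤ N := by exact_mod_cast hN1
  exact max_le (by linarith) (by linarith)

lemma optError_eq_errorBound {T : ℝ} (hT : 0 ≤ T) {M : ℕ} (hM : 1 ≤ M) :
    optError ⊤ 0 T M = errorBound (Real.exp (-T)) M := by
  have hp := Real.exp_pos (-T)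
  have hp1 : Real.exp (-T) ≤ 1 := Real.exp_le_one_iff.2 (by linarith)
  suffices h : {ε : ℝ | 0 ≤ ε ∧ (M : ℕ∞) ≤ maxMessages ⊤ 0 T ε}
      = Set.Ici (errorBound (Real.exp (-T)) M) by
    rw [optError, h, csInf_Ici]
  ext ε
  refine ⟨fun ⟨_, h⟩ => ?_, fun h => ⟨(errorBound_nonneg hp.le hp1 M).trans h,
    le_iSup₂_of_le M ((mem_achievable_iff hT).2 ⟨hM, h⟩) le_rfl⟩⟩
  -- Passing to `M - 1` makes the inequality strict, so some achievable `N ≥ M` exists even if the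
  -- supremum is not attained; monotonicity of `errorBound` does the rest.
  have hlt : ((M - 1 : ℕ) : ℕ∞) < maxMessages ⊤ 0 T ε :=
    (Nat.cast_lt.2 (Nat.sub_lt hM one_pos)).trans_le h
  rw [maxMessages] at hlt
  simp only [lt_iSup_iff] at hlt
  obtain ⟨N, hN, hMN⟩ := hlt
  rw [mem_achievable_iff hT] at hN
  have hMN' : M ≤ N := by
    have := Nat.cast_lt.1 hMN
    omega
  exact (errorBound_mono hp.le hp1 hM hMN').trans hN.2

/-- As `exp (T * R) > 1`, the ceiling `M` is at least 2, so `M - 1` lies between `exp (T * R) / 2`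
and `exp (T * R)`. The constants 8 and 2 disappear in the exponent. -/
lemma optError_ceil_bounds {R T : ℝ} (hR : 0 < R) (hR1 : R < 1) (hT : 0 < T) :
    Real.exp (-(T * (1 - R))) / 8 ≤ optError ⊤ 0 T ⌈Real.exp (T * R)⌉₊ ∧
      optError ⊤ 0 T ⌈Real.exp (T * R)⌉₊ ≤ Real.exp (-(T * (1 - R))) / 2 := by
  have hp := Real.exp_pos (-T)
  have hp1 : Real.exp (-T) ≤ 1 := Real.exp_le_one_iff.2 (by linarith)
  set M := ⌈Real.exp (T * R)⌉₊ with hMdef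
  have hlow : Real.exp (T * R) ≤ M := Nat.le_ceil _
  have hup : (M : ℝ) < Real.exp (T * R) + 1 := Nat.ceil_lt_add_one (Real.exp_pos _).le
  have h2 : 2 ≤ M := by
    have : (1 : ℝ) < M := (Real.one_lt_exp_iff.2 (mul_pos hT hR)).trans_le hlow
    exact_mod_cast this
  have h2' : (2 : ℝ) ≤ M := by exact_mod_cast h2
  have hM : 1 ≤ M := by omega
  have hexp : Real.exp (T * R) * Real.exp (-T) = Real.exp (-(T * (1 - R))) := by
    rw [← Real.exp_add]
    congr 1
    ring
  have hle : Real.exp (-(T * (1 - R))) ≤ 1 :=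
    Real.exp_le_one_iff.2 (by nlinarith [mul_pos hT (sub_pos.2 hR1)])
  have hMp : ((M : ℝ) - 1) * Real.exp (-T) ≤ Real.exp (-(T * (1 - R))) := by
    rw [← hexp]
    exact mul_le_mul_of_nonneg_right (by linarith) hp.le
  have hMp' : Real.exp (-(T * (1 - R))) ≤ 2 * (((M : ℝ) - 1) * Real.exp (-T)) := by
    rw [← hexp, ← mul_assoc]
    exact mul_le_mul_of_nonneg_right (by linarith) hp.le
  rw [optError_eq_errorBound hT.le hM]
  refine ⟨le_trans ?_ (le_errorBound hp.le hp1 hM), (errorBound_le hp1 hM).trans (by linarith)⟩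
  have h5 : 1 / 2 ≤ 1 - ((M : ℝ) - 2) * Real.exp (-T) / 3 := by nlinarith
  have h6 := mul_le_mul_of_nonneg_left h5
    (by nlinarith : (0 : ℝ) ≤ ((M : ℝ) - 1) * Real.exp (-T) / 2)
  linarith

lemma tendsto_error_exponent {R : ℝ} (hR : 0 < R) (hR1 : R < 1) :
    Tendsto (fun T : ℝ => T⁻¹ * Real.log (1 / optError ⊤ 0 T ⌈Real.exp (T * R)⌉₊)) atTop
      (𝓝 (1 - R)) := by
  have hlim : ∀ c : ℝ, Tendsto (fun T : ℝ => (1 - R) + T⁻¹ * c) atTop (𝓝 (1 - R)) := fun c => by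
    simpa using tendsto_const_nhds.add (tendsto_inv_atTop_zero.mul_const c)
  have hlog : ∀ T c : ℝ, 0 < T → 0 < c →
      T⁻¹ * Real.log (1 / (Real.exp (-(T * (1 - R))) / c)) = (1 - R) + T⁻¹ * Real.log c := by
    intro T c hT hc
    rw [one_div, Real.log_inv, Real.log_div (Real.exp_pos _).ne' hc.ne', Real.log_exp]
    field_simp
    ring
  refine tendsto_of_tendsto_of_tendsto_of_le_of_le' (hlim (Real.log 2)) (hlim (Real.log 8)) ?_ ?_
  · filter_upwards [eventually_gt_atTop 0] with T hT
    obtain ⟨h1, h2⟩ := optError_ceil_bounds hR hR1 hT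
    have hpos := (div_pos (Real.exp_pos (-(T * (1 - R)))) (by norm_num : (0 : ℝ) < 8)).trans_le h1
    rw [← hlog T 2 hT two_pos]
    gcongr
  · filter_upwards [eventually_gt_atTop 0] with T hT
    obtain ⟨h1, h2⟩ := optError_ceil_bounds hR hR1 hT
    have hpos := (div_pos (Real.exp_pos (-(T * (1 - R)))) (by norm_num : (0 : ℝ) < 8)).trans_le h1
    rw [← hlog T 8 hT (by norm_num)]
    gcongr

end

end OCPC

theorem corollary1 :
    (∀ T ε : ℝ, 0 < T → 0 < ε → ε ≤ 1 / 12 →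
      ∃ m : ℕ, IsGreatest (OCPC.achievable ⊤ 0 T ε) m ∧ OCPC.maxMessages ⊤ 0 T ε = (m : ℕ∞) ∧
        Real.log (m : ℝ) - max (T - Real.log (1 / ε)) 0 ∈ Set.Icc (0 : ℝ) 2) ∧
    (∀ R : ℝ, 0 < R → R < 1 →
      (∀ T : ℝ, 0 < T → 0 < OCPC.optError ⊤ 0 T ⌈Real.exp (T * R)⌉₊) ∧
      Filter.liminf
        (fun T : ℝ =>
          ((T⁻¹ * Real.log (1 / OCPC.optError ⊤ 0 T ⌈Real.exp (T * R)⌉₊) : ℝ) : EReal))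
        Filter.atTop = ((1 - R : ℝ) : EReal)) := by
  refine ⟨fun T ε hT hε hε' => ?_, fun R hR hR1 => ⟨fun T hT => ?_, ?_⟩⟩
  · obtain ⟨m, hm, hlow, hup⟩ := OCPC.exists_isGreatest_achievable hT.le hε hε'
    refine ⟨m, hm, OCPC.maxMessages_eq_of_isGreatest hm, ?_⟩
    have hmax0 : 0 < max (ε * Real.exp T) 1 := lt_max_of_lt_right one_pos
    -- The interval `[0, 2]` is the logarithm of the bounds `1` and `exp 2` on the ratio of `m` to
    -- `max (ε * exp T) 1`.
    have hmax : max (T - Real.log (1 / ε)) 0 = Real.log (max (ε * Real.exp T) 1) := by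
      rw [Real.strictMonoOn_log.monotoneOn.map_max (Set.mem_Ioi.2 (mul_pos hε (Real.exp_pos T)))
        (Set.mem_Ioi.2 one_pos), Real.log_one, Real.log_mul hε.ne' (Real.exp_pos T).ne',
        Real.log_exp, one_div, Real.log_inv, sub_neg_eq_add, add_comm]
    have h1 := Real.log_le_log hmax0 hlow
    have h2 := Real.log_le_log (hmax0.trans_le hlow) hup
    rw [Real.log_mul (Real.exp_pos 2).ne' hmax0.ne', Real.log_exp] at h2
    rw [hmax]
    exact ⟨by linarith, by linarith⟩
  · exact (by positivity : 0 < Real.exp (-(T * (1 - R))) / 8).trans_le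
      (OCPC.optError_ceil_bounds hR hR1 hT).1
  · exact ((continuous_coe_real_ereal.tendsto _).comp
      (OCPC.tendsto_error_exponent hR hR1)).liminf_eq
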